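/- **Setting.** For a complex Hilbert space $\mathcal H$ let $\mathcal V(\mathcal H)$ be the poset, under inclusion, of commutative (unital) von Neumann subalgebras of $\mathcal B(\mathcal H)$, and let $\underline\Sigma^{\mathcal H}$ be the presheaf on it with $\underline\Sigma^{\mathcal H}_V$ the set of unital multiplicative linear functionals $V\to\mathbb C$ and restriction as structure maps. For a projection $\hat P$ put $\delta(\hat P)_V=\bigwedge\{\hat R\in P(V)\mid \hat R\ge\hat P\}$ and let $\underline{\delta(\hat P)}\subseteq\underline\Sigma^{\mathcal H}$ be the subobject $\underline{\delta(\hat P)}_V=\{\lambda\in\underline\Sigma^{\mathcal H}_V\mid\lambda(\delta(\hat P)_V)=1\}$. For a unit vector $\psi$ let $\underline{\mathfrak w}^{\psi}=\underline{\delta(|\psi\rangle\langle\psi|)}$. For a poset $\mathcal P$ let $\Gamma\Omega^{\mathcal P}$ be the frame of global elements of the subobject classifier of presheaves on $\mathcal P$, i.e. of compatible families of sieves (downward closed sets of elements below $V$) for $V\in\mathcal P$; for subobjects $T,S$ of a presheaf on $\mathcal P$ put $v(T\subseteq S)(V)=\{V'\le V\mid T_{V'}\subseteq S_{V'}\}$.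 For frames $A,B$ let $A\otimes B$ be the frame generated by symbols $a\otimes b$ subject to preservation of finite meets and of joins in each variable. Let $\mathcal H_{t_1}$ and $\mathcal H_{t_2}\cong\mathcal H_{t_1}$ be Hilbert spaces, $\psi_{t_1}\in\mathcal H_{t_1}$ a unit vector, and $\psi_{t_2}\in\mathcal H_{t_2}$ the copy of $\hat U\psi_{t_1}$, where $\hat U$ is a unitary operator. Write $\mathcal V_k=\mathcal V(\mathcal H_{t_k})$, $\underline\Sigma_k=\underline\Sigma^{\mathcal H_{t_k}}$, and let $p_1,p_2$ be the projections of $\mathcal V_1\times\mathcal V_2$. An element $\underline S_1\otimes\underline S_2$ of $\mathrm{Sub}(\underline\Sigma_1)\otimes\mathrm{Sub}(\underline\Sigma_2)$ is regarded as the subobject $p_1^*\underline S_1\times p_2^*\underline S_2$ of the presheaf $p_1^*\underline\Sigma_1\times p_2^*\underline\Sigma_2$ on $\mathcal V_1\times\mathcal V_2$. Let $$j:\Gamma\Omega^{\mathcal V_1}\otimes\Gamma\Omega^{\mathcal V_2}\to\Gamma\Omega^{\mathcal V_1\times\mathcal V_2}$$ be the frame homomorphism given on generators by $j(\omega_1\otimes\omega_2)(\langle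 V_1,V_2\rangle)=\omega_1(V_1)\times\omega_2(V_2)$, the set of all pairs $\langle V_1',V_2'\rangle$ with $V_1'\in\omega_1(V_1)$ and $V_2'\in\omega_2(V_2)$. **Claim.** The map $j$ is an isomorphism of frames. For all subobjects $\underline S_1\subseteq\underline\Sigma_1$ and $\underline S_2\subseteq\underline\Sigma_2$ and all $\langle V_1,V_2\rangle$, $$v(\underline{\mathfrak w}^{\psi_{t_1}}\otimes\underline{\mathfrak w}^{\psi_{t_2}}\subseteq\underline S_1\otimes\underline S_2)(\langle V_1,V_2\rangle)=v(\underline{\mathfrak w}^{\psi_{t_1}}\subseteq\underline S_1)(V_1)\times v(\underline{\mathfrak w}^{\psi_{t_2}}\subseteq\underline S_2)(V_2),$$ and hence $$v(\underline{\mathfrak w}^{\psi_{t_1}}\otimes\underline{\mathfrak w}^{\psi_{t_2}}\subseteq\underline S_1\otimes\underline S_2)=j\big(v(\underline{\mathfrak w}^{\psi_{t_1}}\subseteq\underline S_1)\otimes v(\underline{\mathfrak w}^{\psi_{t_2}}\subseteq\underline S_2)\big).$$ In particular, let $\hat A_1,\hat A_2$ be self-adjoint operators on $\mathcal H_{t_1},\mathcal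 H_{t_2}$ with spectral projections $\hat E[A_k\in\Delta_k]$ for Borel sets $\Delta_k\subseteq\mathbb R$, and let the homogeneous history $(A_1\in\Delta_1)_{t_1}\sqcap(A_2\in\Delta_2)_{t_2}$ be represented by $\underline{\delta(\hat E[A_1\in\Delta_1])}\otimes\underline{\delta(\hat E[A_2\in\Delta_2])}$. Then its truth value is $$v\big((A_1\in\Delta_1)_{t_1}\sqcap(A_2\in\Delta_2)_{t_2};\psi_{t_1}\big)=j\Big(v\big(\underline{\mathfrak w}^{\psi_{t_1}}\subseteq\underline{\delta(\hat E[A_1\in\Delta_1])}\big)\otimes v\big(\underline{\mathfrak w}^{\psi_{t_2}}\subseteq\underline{\delta(\hat E[A_2\in\Delta_2])}\big)\Big).$$ -/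

import Mathlib

open CategoryTheory Opposite

universe u

/-! ## Tensor product of frames -/

/-- An element of the tensor product of two frames: a set of pairs `(a, b)` (to be thought of as the
formal join of the `a ⊗ b`) which is downward closed and closed under joins in each variable. -/
@[ext]
structure FrameTensor (A B : Type u) [Order.Frame A] [Order.Frame B] where
  carrier : Set (A × B)
  lower : ∀ {a a' : A} {b b' : B}, a' ≤ a → b' ≤ b → (a, b) ∈ carrier → (a', b') ∈ carrier
  sSup_left : ∀ (s : Set A) (b : B), (∀ a ∈ s, (a, b) ∈ carrier) → (sSup s, b) ∈ carrier
  sSup_right : ∀ (a : A) (t : Set B), (∀ b ∈ t, (a, b) ∈ carrier) → (a, sSup t) ∈ carrier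

namespace FrameTensor

variable {A B C : Type u} [Order.Frame A] [Order.Frame B] [Order.Frame C]

instance : PartialOrder (FrameTensor A B) :=
  PartialOrder.lift FrameTensor.carrier (fun _ _ h => FrameTensor.ext h)

theorem le_iff {D E : FrameTensor A B} : D ≤ E ↔ D.carrier ⊆ E.carrier := Iff.rfl

instance : InfSet (FrameTensor A B) where
  sInf S :=
    { carrier := {x | ∀ D ∈ S, x ∈ D.carrier}
      lower := fun ha hb h D hD => D.lower ha hb (h D hD)
      sSup_left := fun s b h D hD => D.sSup_left s b fun a ha => h a ha D hD
      sSup_right := fun a t h D hD => D.sSup_right a t fun b hb => h b hb D hD }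

instance : CompleteLattice (FrameTensor A B) where
  __ := completeLatticeOfInf (FrameTensor A B) fun S =>
    ⟨fun D hD _ hx => hx D hD, fun _ hE _ hx D hD => hE hD hx⟩
  inf D E :=
    { carrier := D.carrier ∩ E.carrier
      lower := fun ha hb h => ⟨D.lower ha hb h.1, E.lower ha hb h.2⟩
      sSup_left := fun s b h =>
        ⟨D.sSup_left s b fun a ha => (h a ha).1, E.sSup_left s b fun a ha => (h a ha).2⟩
      sSup_right := fun a t h =>
        ⟨D.sSup_right a t fun b hb => (h b hb).1, E.sSup_right a t fun b hb => (h b hb).2⟩ }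
  inf_le_left _ _ _ h := h.1
  inf_le_right _ _ _ h := h.2
  le_inf _ _ _ h₁ h₂ _ h := ⟨h₁ h, h₂ h⟩
  top :=
    { carrier := Set.univ
      lower := fun _ _ _ => trivial
      sSup_left := fun _ _ _ => trivial
      sSup_right := fun _ _ _ => trivial }
  le_top _ _ _ := trivial

theorem mem_inf {D E : FrameTensor A B} {x : A × B} :
    x ∈ (D ⊓ E).carrier ↔ x ∈ D.carrier ∧ x ∈ E.carrier := Iff.rfl

/-- The relative pseudo-complement. -/
def imp (D E : FrameTensor A B) : FrameTensor A B where
  carrier := {x | ∀ y ∈ D.carrier, (x.1 ⊓ y.1, x.2 ⊓ y.2) ∈ E.carrier}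
  lower := fun ha hb h y hy =>
    E.lower (inf_le_inf_right _ ha) (inf_le_inf_right _ hb) (h y hy)
  sSup_left := fun s b h y hy => by
    have := E.sSup_left ((fun a => a ⊓ y.1) '' s) (b ⊓ y.2) (by
      rintro _ ⟨a, ha, rfl⟩
      exact h a ha y hy)
    rwa [sSup_image, ← sSup_inf_eq] at this
  sSup_right := fun a t h y hy => by
    have := E.sSup_right (a ⊓ y.1) ((fun b => b ⊓ y.2) '' t) (by
      rintro _ ⟨b, hb, rfl⟩
      exact h b hb y hy)
    rwa [sSup_image, ← sSup_inf_eq] at this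

theorem le_imp_iff {F D E : FrameTensor A B} : F ≤ imp D E ↔ F ⊓ D ≤ E := by
  constructor
  · rintro h ⟨a, b⟩ ⟨h₁, h₂⟩
    simpa using h h₁ _ h₂
  · rintro h ⟨a, b⟩ hab ⟨c, d⟩ hcd
    exact h ⟨F.lower inf_le_left inf_le_left hab, D.lower inf_le_right inf_le_right hcd⟩

instance : Order.Frame (FrameTensor A B) := Order.Frame.ofMinimalAxioms
  { inf_sSup_le_iSup_inf := fun a s => by
      rw [inf_comm, ← le_imp_iff]
      refine sSup_le fun b hb => le_imp_iff.2 ?_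
      rw [inf_comm]
      exact le_iSup₂_of_le b hb le_rfl }

/-- The generator `a ⊗ b`. -/
def tmul (a : A) (b : B) : FrameTensor A B where
  carrier := {x | x.1 = ⊥ ∨ x.2 = ⊥ ∨ (x.1 ≤ a ∧ x.2 ≤ b)}
  lower := by
    rintro x x' y y' hx hy (h | h | h)
    · exact Or.inl (le_bot_iff.1 (h ▸ hx))
    · exact Or.inr (Or.inl (le_bot_iff.1 (h ▸ hy)))
    · exact Or.inr (Or.inr ⟨hx.trans h.1, hy.trans h.2⟩)
  sSup_left := fun s y h => by
    by_cases hy : y = ⊥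
    · exact Or.inr (Or.inl hy)
    by_cases hs : ∀ x ∈ s, x = ⊥
    · exact Or.inl (sSup_eq_bot.2 hs)
    push Not at hs
    obtain ⟨x, hx, hx0⟩ := hs
    have hyb : y ≤ b := by
      rcases h x hx with h | h | h
      · exact absurd h hx0
      · exact absurd h hy
      · exact h.2
    refine Or.inr (Or.inr ⟨sSup_le fun z hz => ?_, hyb⟩)
    rcases h z hz with h | h | h
    · exact h.le.trans bot_le
    · exact absurd h hy
    · exact h.1
  sSup_right := fun x t h => by
    by_cases hx : x = ⊥
    · exact Or.inl hx
    by_cases ht : ∀ y ∈ t, y = ⊥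
    · exact Or.inr (Or.inl (sSup_eq_bot.2 ht))
    push Not at ht
    obtain ⟨y, hy, hy0⟩ := ht
    have hxa : x ≤ a := by
      rcases h y hy with h | h | h
      · exact absurd h hx
      · exact absurd h hy0
      · exact h.1
    refine Or.inr (Or.inr ⟨hxa, sSup_le fun z hz => ?_⟩)
    rcases h z hz with h | h | h
    · exact absurd h hx
    · exact h.le.trans bot_le
    · exact h.2

theorem tmul_le_iff {a : A} {b : B} {D : FrameTensor A B} :
    tmul a b ≤ D ↔ (a, b) ∈ D.carrier := by
  constructor
  · intro h
    exact h (Or.inr (Or.inr ⟨le_rfl, le_rfl⟩))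
  · rintro h ⟨x, y⟩ (hx | hy | hxy)
    · obtain rfl : x = ⊥ := hx
      simpa using D.sSup_left ∅ y (by simp)
    · obtain rfl : y = ⊥ := hy
      simpa using D.sSup_right x ∅ (by simp)
    · exact D.lower hxy.1 hxy.2 h

/-- Every element is a join of generators. -/
theorem eq_iSup_tmul (D : FrameTensor A B) : D = ⨆ x ∈ D.carrier, tmul x.1 x.2 :=
  le_antisymm
    (fun x hx => tmul_le_iff.1 (le_iSup₂_of_le (f := fun x (_ : x ∈ D.carrier) => tmul x.1 x.2)
      x hx le_rfl))
    (iSup₂_le fun _ hx => tmul_le_iff.2 hx)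

/-! The defining relations of the tensor product. -/

theorem tmul_inf_tmul (a a' : A) (b b' : B) :
    tmul a b ⊓ tmul a' b' = tmul (a ⊓ a') (b ⊓ b') := by
  ext ⟨x, y⟩
  change ((x = ⊥ ∨ y = ⊥ ∨ _) ∧ (x = ⊥ ∨ y = ⊥ ∨ _)) ↔ (x = ⊥ ∨ y = ⊥ ∨ _)
  simp only [le_inf_iff]
  tauto

theorem tmul_top_top : tmul (⊤ : A) (⊤ : B) = ⊤ :=
  top_le_iff.1 fun _ _ => Or.inr (Or.inr ⟨le_top, le_top⟩)

theorem tmul_sSup_left (s : Set A) (b : B) : tmul (sSup s) b = ⨆ a ∈ s, tmul a b :=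
  le_antisymm
    (tmul_le_iff.2 (FrameTensor.sSup_left _ s b fun a ha =>
      tmul_le_iff.1 (le_iSup₂_of_le (f := fun a (_ : a ∈ s) => tmul a b) a ha le_rfl)))
    (iSup₂_le fun _ ha => tmul_le_iff.2 (Or.inr (Or.inr ⟨le_sSup ha, le_rfl⟩)))

theorem tmul_sSup_right (a : A) (t : Set B) : tmul a (sSup t) = ⨆ b ∈ t, tmul a b :=
  le_antisymm
    (tmul_le_iff.2 (FrameTensor.sSup_right _ a t fun b hb =>
      tmul_le_iff.1 (le_iSup₂_of_le (f := fun b (_ : b ∈ t) => tmul a b) b hb le_rfl)))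
    (iSup₂_le fun _ hb => tmul_le_iff.2 (Or.inr (Or.inr ⟨le_rfl, le_sSup hb⟩)))

/-- A map on pairs which respects the defining relations of the tensor product. -/
structure IsBimorphism (f : A → B → C) : Prop where
  map_inf : ∀ a a' b b', f (a ⊓ a') (b ⊓ b') = f a b ⊓ f a' b'
  map_top : f ⊤ ⊤ = ⊤
  map_sSup_left : ∀ (s : Set A) (b : B), f (sSup s) b = ⨆ a ∈ s, f a b
  map_sSup_right : ∀ (a : A) (t : Set B), f a (sSup t) = ⨆ b ∈ t, f a b

theorem IsBimorphism.mono {f : A → B → C} (hf : IsBimorphism f) {a a' : A} {b b' : B}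
    (ha : a' ≤ a) (hb : b' ≤ b) : f a' b' ≤ f a b := by
  have := hf.map_inf a' a b' b
  rw [inf_eq_left.2 ha, inf_eq_left.2 hb] at this
  rw [this]
  exact inf_le_right

/-- The right adjoint of `lift f`. -/
def IsBimorphism.below {f : A → B → C} (hf : IsBimorphism f) (c : C) : FrameTensor A B where
  carrier := {x | f x.1 x.2 ≤ c}
  lower := fun ha hb h => (hf.mono ha hb).trans h
  sSup_left := fun s b h => by
    change f (sSup s) b ≤ c
    rw [hf.map_sSup_left]
    exact iSup₂_le h
  sSup_right := fun a t h => by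
    change f a (sSup t) ≤ c
    rw [hf.map_sSup_right]
    exact iSup₂_le h

theorem IsBimorphism.gc {f : A → B → C} (hf : IsBimorphism f) :
    GaloisConnection (fun D : FrameTensor A B => ⨆ x ∈ D.carrier, f x.1 x.2) hf.below :=
  fun D c => by
    simp only [iSup_le_iff]
    exact Iff.rfl

/-- The frame homomorphism out of the tensor product that is defined by its values on generators. -/
def lift (f : A → B → C) (hf : IsBimorphism f) : FrameHom (FrameTensor A B) C where
  toFun D := ⨆ x ∈ D.carrier, f x.1 x.2
  map_inf' D E := by
    refine le_antisymm (le_inf (hf.gc.monotone_l inf_le_left) (hf.gc.monotone_l inf_le_right)) ?_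
    simp only [iSup_inf_eq, inf_iSup_eq]
    refine iSup₂_le fun y hy => iSup₂_le fun x hx => ?_
    rw [← hf.map_inf]
    exact le_iSup₂_of_le (f := fun x (_ : x ∈ (D ⊓ E).carrier) => f x.1 x.2)
      (x.1 ⊓ y.1, x.2 ⊓ y.2)
      ⟨D.lower inf_le_left inf_le_left (a := x.1) (b := x.2) hx,
        E.lower inf_le_right inf_le_right (b := y.2) (a := y.1) hy⟩ le_rfl
  map_top' := top_le_iff.1 <| by
    rw [← hf.map_top]
    exact le_iSup₂_of_le (f := fun x (_ : x ∈ (⊤ : FrameTensor A B).carrier) => f x.1 x.2)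
      (⊤, ⊤) trivial le_rfl
  map_sSup' S := by
    rw [sSup_image]
    exact hf.gc.l_sSup

@[simp]
theorem lift_tmul (f : A → B → C) (hf : IsBimorphism f) (a : A) (b : B) :
    lift f hf (tmul a b) = f a b :=
  le_antisymm ((hf.gc (tmul a b) (f a b)).2 (tmul_le_iff.2 le_rfl))
    (le_iSup₂_of_le (f := fun x (_ : x ∈ (tmul a b).carrier) => f x.1 x.2) (a, b)
      (Or.inr (Or.inr ⟨le_rfl, le_rfl⟩)) le_rfl)

/-- A frame homomorphism out of the tensor product is determined by its values on generators. -/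
theorem hom_ext {g g' : FrameHom (FrameTensor A B) C}
    (h : ∀ a b, g (tmul a b) = g' (tmul a b)) : g = g' := by
  ext D
  rw [eq_iSup_tmul D]
  simp only [map_iSup, h]

end FrameTensor

/-! ## Presheaves on a poset -/

instance {C : Type u} [Category.{u} C] (F : C ⥤ Type u) : Order.Frame (Subfunctor F) :=
  Order.Frame.ofMinimalAxioms
    { inf_sSup_le_iSup_inf := fun a s => by
        rw [inf_comm, sSup_eq_iSup]
        simp only [Subfunctor.iSup_min]
        exact iSup₂_mono fun b _ => (inf_comm b a).le }

/-- A sieve on `V` in a poset: a downward closed set of stages below `V`. -/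
@[ext]
structure StageSieve {P : Type u} [PartialOrder P] (V : P) where
  carrier : Set P
  le_stage : ∀ {W}, W ∈ carrier → W ≤ V
  down : ∀ {W W'}, W' ≤ W → W ∈ carrier → W' ∈ carrier

/-- The subobject classifier of the topos of presheaves on the poset `P`. -/
def omega (P : Type u) [PartialOrder P] : Pᵒᵖ ⥤ Type u where
  obj V := StageSieve V.unop
  map {V V'} _ := ↾fun σ : StageSieve V.unop =>
    ({ carrier := {W | W ≤ V'.unop ∧ W ∈ σ.carrier}
       le_stage := fun h => h.1
       down := fun hle h => ⟨hle.trans h.1, σ.down hle h.2⟩ } : StageSieve V'.unop)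
  map_id V := by
    ext σ W
    exact ⟨fun h => h.2, fun h => ⟨σ.le_stage h, h⟩⟩
  map_comp {V V' V''} f g := by
    ext σ W
    exact ⟨fun h => ⟨h.1, h.1.trans (leOfHom g.unop), h.2⟩, fun h => ⟨h.1, h.2.2⟩⟩

/-- The global elements of the subobject classifier. -/
def GammaOmega (P : Type u) [PartialOrder P] : Type u := (omega P).sections

namespace GammaOmega

variable {P : Type u} [PartialOrder P]

/-- The sieve on `V` given by a global element, as a set of stages. -/
def stage (ω : GammaOmega P) (V : P) : Set P := StageSieve.carrier (ω.1 (op V))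

theorem le_stage (ω : GammaOmega P) {V W : P} (h : W ∈ ω.stage V) : W ≤ V :=
  StageSieve.le_stage (ω.1 (op V)) h

theorem mem_stage_iff (ω : GammaOmega P) {V V' W : P} (h : V' ≤ V) :
    W ∈ ω.stage V' ↔ W ≤ V' ∧ W ∈ ω.stage V := by
  have := ω.2 (homOfLE h).op
  unfold stage
  rw [← this]
  exact Iff.rfl

@[ext]
theorem ext {ω ω' : GammaOmega P} (h : ∀ V, ω.stage V = ω'.stage V) : ω = ω' :=
  Subtype.ext (funext fun V => StageSieve.ext (h V.unop))

/-- Construct a global element from its sieves. -/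
def mk (s : P → Set P) (le_stage : ∀ {V W}, W ∈ s V → W ≤ V)
    (down : ∀ {V W W'}, W' ≤ W → W ∈ s V → W' ∈ s V)
    (compat : ∀ {V V' W}, V' ≤ V → (W ∈ s V' ↔ W ≤ V' ∧ W ∈ s V)) : GammaOmega P :=
  ⟨fun V => ({ carrier := s V.unop, le_stage := le_stage, down := down } : StageSieve V.unop),
    fun {V V'} f => by
      apply StageSieve.ext
      ext W
      exact (compat (leOfHom f.unop)).symm⟩

@[simp]
theorem stage_mk (s : P → Set P) (h₁ h₂ h₃) (V : P) : (mk s h₁ h₂ h₃).stage V = s V := rfl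

theorem stage_down (ω : GammaOmega P) {V W W' : P} (hle : W' ≤ W) (h : W ∈ ω.stage V) :
    W' ∈ ω.stage V :=
  StageSieve.down (ω.1 (op V)) hle h

/-! The order is stagewise inclusion of sieves. -/

instance : PartialOrder (GammaOmega P) :=
  PartialOrder.lift stage (fun _ _ h => GammaOmega.ext (congrFun h))

theorem le_iff {ω ω' : GammaOmega P} : ω ≤ ω' ↔ ∀ V, ω.stage V ⊆ ω'.stage V := Iff.rfl

instance : SupSet (GammaOmega P) where
  sSup S := mk (fun V => {W | ∃ ω ∈ S, W ∈ ω.stage V})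
    (fun ⟨ω, _, h⟩ => ω.le_stage h)
    (fun hle ⟨ω, hω, h⟩ => ⟨ω, hω, ω.stage_down hle h⟩)
    (fun hle =>
      ⟨fun ⟨ω, hω, h⟩ => ⟨ω.le_stage h, ω, hω, ((ω.mem_stage_iff hle).1 h).2⟩,
        fun ⟨h', ω, hω, h⟩ => ⟨ω, hω, (ω.mem_stage_iff hle).2 ⟨h', h⟩⟩⟩)

theorem mem_stage_sSup {S : Set (GammaOmega P)} {V W : P} :
    W ∈ (sSup S).stage V ↔ ∃ ω ∈ S, W ∈ ω.stage V := Iff.rfl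

instance : CompleteLattice (GammaOmega P) where
  __ := completeLatticeOfSup (GammaOmega P) fun _ =>
    ⟨fun ω hω _ _ h => ⟨ω, hω, h⟩, fun _ hω V _ h => by
      obtain ⟨_, hω', h⟩ := h
      exact hω hω' V h⟩
  inf ω ω' := mk (fun V => ω.stage V ∩ ω'.stage V)
    (fun h => ω.le_stage h.1)
    (fun hle h => ⟨ω.stage_down hle h.1, ω'.stage_down hle h.2⟩)
    (fun hle => by
      simp only [Set.mem_inter_iff, ω.mem_stage_iff hle, ω'.mem_stage_iff hle]
      tauto)
  inf_le_left _ _ _ _ h := h.1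
  inf_le_right _ _ _ _ h := h.2
  le_inf _ _ _ h₁ h₂ _ _ h := ⟨h₁ _ h, h₂ _ h⟩
  top := mk (fun V => {W | W ≤ V}) (fun h => h) (fun hle h => le_trans hle h)
    (fun hle => ⟨fun h => ⟨h, le_trans h hle⟩, fun h => h.1⟩)
  le_top ω _ _ h := ω.le_stage h

instance : Order.Frame (GammaOmega P) := Order.Frame.ofMinimalAxioms
  { inf_sSup_le_iSup_inf := fun _ _ _ _ ⟨h, _, hω, h'⟩ =>
      le_iff.1 (le_iSup₂_of_le _ hω le_rfl) _ ⟨h, h'⟩ }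

end GammaOmega

/-- Every element of `T` at a stage is the restriction of an element of `T` at any larger stage. -/
def RestrictsOnto {P : Type u} [PartialOrder P] {X : Pᵒᵖ ⥤ Type u} (T : Subfunctor X) : Prop :=
  ∀ ⦃V V' : P⦄ (h : V' ≤ V), ∀ x ∈ T.obj (op V'), ∃ y ∈ T.obj (op V), X.map (homOfLE h).op y = x

/-- The generalised truth value of `T ⊆ S`: at `V` it is the set of all `V' ≤ V` such that
`T_{V'} ⊆ S_{V'}`. The condition on `T` guarantees that these sets are sieves. -/
def truthValue {P : Type u} [PartialOrder P] {X : Pᵒᵖ ⥤ Type u} (T S : Subfunctor X)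
    (hT : RestrictsOnto T) : GammaOmega P :=
  GammaOmega.mk (fun V => {V' | V' ≤ V ∧ T.obj (op V') ⊆ S.obj (op V')})
    (fun h => h.1)
    (fun {V W W'} hle h => ⟨hle.trans h.1, fun x hx => by
      obtain ⟨y, hy, rfl⟩ := hT hle x hx
      exact S.map (homOfLE hle).op (h.2 hy)⟩)
    (fun hle => ⟨fun h => ⟨h.1, h.1.trans hle, h.2⟩, fun h => ⟨h.1, h.2.2⟩⟩)

/-! ## The product of two stage posets and the intermediate topos -/

/-- Pairs of stages, ordered componentwise. -/
def StagePair (P Q : Type u) : Type u := P × Q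

namespace StagePair

variable {P Q : Type u}

/-- The first stage of a pair. -/
def fst (V : StagePair P Q) : P := Prod.fst V

/-- The second stage of a pair. -/
def snd (V : StagePair P Q) : Q := Prod.snd V

/-- The pair of two stages. -/
def mk (V : P) (W : Q) : StagePair P Q := (V, W)

variable [PartialOrder P] [PartialOrder Q]

instance : PartialOrder (StagePair P Q) := inferInstanceAs (PartialOrder (P × Q))

theorem le_iff {V W : StagePair P Q} : V ≤ W ↔ V.fst ≤ W.fst ∧ V.snd ≤ W.snd := Iff.rfl

/-- The first projection functor. -/
def p₁ : StagePair P Q ⥤ P := Monotone.functor (f := fst) fun _ _ h => h.1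

/-- The second projection functor. -/
def p₂ : StagePair P Q ⥤ Q := Monotone.functor (f := snd) fun _ _ h => h.2

end StagePair

section Product

variable {P Q : Type u} [PartialOrder P] [PartialOrder Q] {X : Pᵒᵖ ⥤ Type u} {Y : Qᵒᵖ ⥤ Type u}

/-- The presheaf `p₁^* X × p₂^* Y` on pairs of stages. -/
def prodPresheaf (X : Pᵒᵖ ⥤ Type u) (Y : Qᵒᵖ ⥤ Type u) : (StagePair P Q)ᵒᵖ ⥤ Type u :=
  FunctorToTypes.prod (StagePair.p₁.op ⋙ X) (StagePair.p₂.op ⋙ Y)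

/-- The subobject `p₁^* S × p₂^* T` of `p₁^* X × p₂^* Y`. -/
def prodSub (S : Subfunctor X) (T : Subfunctor Y) : Subfunctor (prodPresheaf X Y) where
  obj V := {x : X.obj (op V.unop.fst) × Y.obj (op V.unop.snd) |
    x.1 ∈ S.obj (op V.unop.fst) ∧ x.2 ∈ T.obj (op V.unop.snd)}
  map f _ h := ⟨S.map (StagePair.p₁.op.map f) h.1, T.map (StagePair.p₂.op.map f) h.2⟩

theorem prodSub_isBimorphism :
    FrameTensor.IsBimorphism (prodSub (X := X) (Y := Y)) where
  map_inf S S' T T' := by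
    ext V x
    exact and_and_and_comm
  map_top := by
    ext V x
    exact ⟨fun _ => trivial, fun _ => ⟨trivial, trivial⟩⟩
  map_sSup_left s T := by
    ext V x
    simp only [Subfunctor.iSup_obj, Set.mem_iUnion, exists_prop]
    constructor
    · rintro ⟨⟨_, ⟨S, hS, rfl⟩, h⟩, h'⟩
      exact ⟨S, hS, h, h'⟩
    · rintro ⟨S, hS, h, h'⟩
      exact ⟨⟨_, ⟨S, hS, rfl⟩, h⟩, h'⟩
  map_sSup_right S t := by
    ext V x
    simp only [Subfunctor.iSup_obj, Set.mem_iUnion, exists_prop]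
    constructor
    · rintro ⟨h', ⟨_, ⟨T, hT, rfl⟩, h⟩⟩
      exact ⟨T, hT, h', h⟩
    · rintro ⟨T, hT, h', h⟩
      exact ⟨h', ⟨_, ⟨T, hT, rfl⟩, h⟩⟩

/-- The frame homomorphism `Sub X ⊗ Sub Y → Sub (p₁^* X × p₂^* Y)` with `S ⊗ T ↦ p₁^* S × p₂^* T`. -/
def hHom (X : Pᵒᵖ ⥤ Type u) (Y : Qᵒᵖ ⥤ Type u) :
    FrameHom (FrameTensor (Subfunctor X) (Subfunctor Y)) (Subfunctor (prodPresheaf X Y)) :=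
  FrameTensor.lift prodSub prodSub_isBimorphism

@[simp]
theorem hHom_tmul (S : Subfunctor X) (T : Subfunctor Y) :
    hHom X Y (FrameTensor.tmul S T) = prodSub S T :=
  FrameTensor.lift_tmul _ _ _ _

theorem RestrictsOnto.hHom {S : Subfunctor X} {T : Subfunctor Y} (hS : RestrictsOnto S)
    (hT : RestrictsOnto T) : RestrictsOnto (hHom X Y (FrameTensor.tmul S T)) := by
  rw [hHom_tmul]
  rintro V V' h ⟨x, y⟩ ⟨hx, hy⟩
  obtain ⟨x', hx', ex⟩ := hS h.1 x hx
  obtain ⟨y', hy', ey⟩ := hT h.2 y hy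
  exact ⟨(x', y'), ⟨hx', hy'⟩, Prod.ext ex ey⟩

/-- The global element whose sieve on `⟨V₁, V₂⟩` is the product of the sieves of `ω₁` on `V₁` and of
`ω₂` on `V₂`. -/
def prodGamma (ω₁ : GammaOmega P) (ω₂ : GammaOmega Q) : GammaOmega (StagePair P Q) :=
  GammaOmega.mk (fun V => {W | W.fst ∈ ω₁.stage V.fst ∧ W.snd ∈ ω₂.stage V.snd})
    (fun h => ⟨ω₁.le_stage h.1, ω₂.le_stage h.2⟩)
    (fun hle h => ⟨ω₁.stage_down hle.1 h.1, ω₂.stage_down hle.2 h.2⟩)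
    (fun {V V' W} hle => by
      have h₁ : _ ↔ W.fst ≤ V'.fst ∧ W.fst ∈ ω₁.stage V.fst := ω₁.mem_stage_iff hle.1
      have h₂ : _ ↔ W.snd ≤ V'.snd ∧ W.snd ∈ ω₂.stage V.snd := ω₂.mem_stage_iff hle.2
      change (W.fst ∈ ω₁.stage V'.fst ∧ W.snd ∈ ω₂.stage V'.snd) ↔
        (W.fst ≤ V'.fst ∧ W.snd ≤ V'.snd) ∧ (W.fst ∈ ω₁.stage V.fst ∧ W.snd ∈ ω₂.stage V.snd)
      rw [h₁, h₂]
      exact and_and_and_comm)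

theorem GammaOmega.mem_stage_iSup {P : Type u} [PartialOrder P] {ι : Type u} {s : Set ι}
    {f : ι → GammaOmega P} {V W : P} :
    W ∈ (⨆ i ∈ s, f i).stage V ↔ ∃ i ∈ s, W ∈ (f i).stage V := by
  rw [← sSup_image, GammaOmega.mem_stage_sSup]
  simp

theorem prodGamma_isBimorphism : FrameTensor.IsBimorphism (prodGamma (P := P) (Q := Q)) where
  map_inf ω₁ ω₁' ω₂ ω₂' := by
    ext V W
    exact and_and_and_comm
  map_top := by
    ext V W
    exact Iff.rfl
  map_sSup_left s ω₂ := by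
    ext V W
    rw [GammaOmega.mem_stage_iSup]
    constructor
    · rintro ⟨⟨ω, hω, h⟩, h'⟩
      exact ⟨ω, hω, h, h'⟩
    · rintro ⟨ω, hω, h, h'⟩
      exact ⟨⟨ω, hω, h⟩, h'⟩
  map_sSup_right ω₁ t := by
    ext V W
    rw [GammaOmega.mem_stage_iSup]
    constructor
    · rintro ⟨h', ω, hω, h⟩
      exact ⟨ω, hω, h', h⟩
    · rintro ⟨ω, hω, h', h⟩
      exact ⟨h', ω, hω, h⟩

/-- The pair of sieves `ω₁ V₁`, `ω₂ V₂` is identified with the product sieve on `⟨V₁, V₂⟩`.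
The frame homomorphism `j` from `ΓΩ₁ ⊗ ΓΩ₂` to the global elements of the subobject classifier of
presheaves on pairs of stages. -/
def jHom (P Q : Type u) [PartialOrder P] [PartialOrder Q] :
    FrameHom (FrameTensor (GammaOmega P) (GammaOmega Q)) (GammaOmega (StagePair P Q)) :=
  FrameTensor.lift prodGamma prodGamma_isBimorphism

@[simp]
theorem jHom_tmul (ω₁ : GammaOmega P) (ω₂ : GammaOmega Q) :
    jHom P Q (FrameTensor.tmul ω₁ ω₂) = prodGamma ω₁ ω₂ :=
  FrameTensor.lift_tmul _ _ _ _

end Product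
/-! ## Contexts, the spectral presheaf and daseinization -/

section Hilbert

variable {H : Type u} [NormedAddCommGroup H] [InnerProductSpace ℂ H] [CompleteSpace H]

/-- A context: a commutative von Neumann subalgebra of the bounded operators on `H`. -/
@[ext]
structure Context (H : Type u) [NormedAddCommGroup H] [InnerProductSpace ℂ H]
    [CompleteSpace H] where
  alg : VonNeumannAlgebra H
  comm : ∀ a ∈ alg, ∀ b ∈ alg, a * b = b * a

instance : PartialOrder (Context H) :=
  PartialOrder.lift Context.alg (fun _ _ => Context.ext)

/-- The elements of a context, as a `ℂ`-algebra. -/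
abbrev Context.Elem (V : Context H) : Type u := V.alg.toStarSubalgebra

/-- The inclusion of a subcontext. -/
noncomputable def Context.incl {V' V : Context H} (h : V' ≤ V) : V'.Elem →ₐ[ℂ] V.Elem :=
  (StarSubalgebra.inclusion (S₁ := V'.alg.toStarSubalgebra) (S₂ := V.alg.toStarSubalgebra)
    (fun _ hx => h hx)).toAlgHom

@[simp]
theorem Context.coe_incl {V' V : Context H} (h : V' ≤ V) (a : V'.Elem) :
    ((Context.incl h a : V.Elem) : H →L[ℂ] H) = a := rfl

/-- The spectral presheaf: the set of unital multiplicative linear functionals on each context,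
with restriction of functionals. -/
noncomputable def spectralPresheaf (H : Type u) [NormedAddCommGroup H] [InnerProductSpace ℂ H]
    [CompleteSpace H] : (Context H)ᵒᵖ ⥤ Type u where
  obj V := V.unop.Elem →ₐ[ℂ] ℂ
  map f := ↾fun χ => AlgHom.comp χ (Context.incl (leOfHom f.unop))

/-- The projection operators on `H`, with the operator order. -/
abbrev ProjOp (H : Type u) [NormedAddCommGroup H] [InnerProductSpace ℂ H]
    [CompleteSpace H] : Type u := {p : H →L[ℂ] H // IsStarProjection p}

/-- The intersection of the ranges of all projections in `V` above `p`. -/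
noncomputable def daseinRange (p : ProjOp H) (V : Context H) : Submodule ℂ H :=
  ⨅ r : {r : ProjOp H // (r : H →L[ℂ] H) ∈ V.alg ∧ p ≤ r}, (r.1 : H →L[ℂ] H).range

theorem ProjOp.mem_range_iff (r : ProjOp H) (x : H) :
    x ∈ (r : H →L[ℂ] H).range ↔ (r : H →L[ℂ] H) x = x := by
  constructor
  · rintro ⟨y, rfl⟩
    exact DFunLike.congr_fun r.2.isIdempotentElem.eq y
  · intro h
    exact ⟨x, h⟩

theorem mem_daseinRange {p : ProjOp H} {V : Context H} {x : H} :
    x ∈ daseinRange p V ↔ ∀ r : ProjOp H, (r : H →L[ℂ] H) ∈ V.alg → p ≤ r →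
      (r : H →L[ℂ] H) x = x := by
  simp only [daseinRange, Submodule.mem_iInf]
  constructor
  · intro h r hV hp
    exact (ProjOp.mem_range_iff r x).1 (h ⟨r, hV, hp⟩)
  · intro h r
    exact (ProjOp.mem_range_iff r.1 x).2 (h r.1 r.2.1 r.2.2)

theorem isClosed_daseinRange (p : ProjOp H) (V : Context H) :
    IsClosed (daseinRange p V : Set H) := by
  have : (daseinRange p V : Set H) = ⋂ r : {r : ProjOp H // (r : H →L[ℂ] H) ∈ V.alg ∧ p ≤ r},
      {x | (r.1 : H →L[ℂ] H) x = x} := by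
    ext x
    simp [mem_daseinRange]
  rw [this]
  exact isClosed_iInter fun r => isClosed_eq (r.1 : H →L[ℂ] H).continuous continuous_id

instance (p : ProjOp H) (V : Context H) : (daseinRange p V).HasOrthogonalProjection :=
  have : CompleteSpace (daseinRange p V) := (isClosed_daseinRange p V).completeSpace_coe
  inferInstance

/-- The outer daseinization of `p` at the context `V`: the infimum of all projections in `V` that
are greater than or equal to `p`. -/
noncomputable def dasein (p : ProjOp H) (V : Context H) : ProjOp H :=
  ⟨(daseinRange p V).starProjection, isStarProjection_starProjection⟩

theorem ProjOp.le_iff_mul {p q : ProjOp H} : p ≤ q ↔ (q : H →L[ℂ] H) * p = p :=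
  p.2.le_iff_mul_eq_right q.2

/-- The daseinization is the smallest projection of the context that is above `p`. -/
theorem dasein_isLeast (p : ProjOp H) (V : Context H) :
    IsLeast {r : ProjOp H | (r : H →L[ℂ] H) ∈ V.alg ∧ p ≤ r} (dasein p V) := by
  refine ⟨⟨?_, ?_⟩, ?_⟩
  · refine (VonNeumannAlgebra.IsStarProjection.mem_iff (dasein p V).2 V.alg).2 fun y hy => ?_
    change LinearMap.range ((daseinRange p V).starProjection : H →ₗ[ℂ] H) ∈ _
    rw [Submodule.range_starProjection]
    intro x hx
    rw [Submodule.mem_comap]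
    refine mem_daseinRange.2 fun r hr hpr => ?_
    have h1 := VonNeumannAlgebra.mem_commutant_iff.1 hy r hr
    have h2 := DFunLike.congr_fun h1 x
    have h3 : (r : H →L[ℂ] H) (y x) = y ((r : H →L[ℂ] H) x) := h2
    rw [mem_daseinRange.1 hx r hr hpr] at h3
    exact h3
  · rw [ProjOp.le_iff_mul]
    ext x
    refine Submodule.starProjection_eq_self_iff.2 (mem_daseinRange.2 fun r _ hpr => ?_)
    exact DFunLike.congr_fun (ProjOp.le_iff_mul.1 hpr) x
  · rintro r ⟨hr, hpr⟩
    rw [ProjOp.le_iff_mul]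
    ext x
    exact mem_daseinRange.1 (Submodule.starProjection_apply_mem (daseinRange p V) x) r hr hpr

theorem dasein_mem (p : ProjOp H) (V : Context H) : (dasein p V : H →L[ℂ] H) ∈ V.alg :=
  (dasein_isLeast p V).1.1

/-- The daseinization of `p` at `V`, as an element of `V`. -/
noncomputable def daseinElem (p : ProjOp H) (V : Context H) : V.Elem :=
  ⟨dasein p V, dasein_mem p V⟩

theorem dasein_anti (p : ProjOp H) {V' V : Context H} (h : V' ≤ V) : dasein p V ≤ dasein p V' :=
  (dasein_isLeast p V).2 ⟨h (dasein_mem p V'), (dasein_isLeast p V').1.2⟩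

/-- The subobject of the spectral presheaf which at `V` consists of the functionals that take the
value `1` on the daseinization of `p` at `V`. -/
noncomputable def daseinSub (p : ProjOp H) : Subfunctor (spectralPresheaf H) where
  obj V := {χ : V.unop.Elem →ₐ[ℂ] ℂ | χ (daseinElem p V.unop) = 1}
  map {V V'} f := by
    intro χ₀ hχ
    let χ : V.unop.Elem →ₐ[ℂ] ℂ := χ₀
    have hle := leOfHom f.unop
    change χ (Context.incl hle (daseinElem p V'.unop)) = 1
    have hmul : Context.incl hle (daseinElem p V'.unop) * daseinElem p V.unop =
        daseinElem p V.unop :=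
      Subtype.ext (ProjOp.le_iff_mul.1 (dasein_anti p hle))
    have h1 := congrArg χ hmul
    have h2 : χ (daseinElem p V.unop) = 1 := hχ
    rwa [map_mul, h2, mul_one] at h1

/-! ### Characters of a subcontext extend to larger contexts -/

theorem Context.mem_of_commute (V : Context H) {a : H →L[ℂ] H}
    (h : ∀ y ∈ V.alg.commutant, y * a = a * y) : a ∈ V.alg := by
  rw [← VonNeumannAlgebra.commutant_commutant V.alg]
  exact VonNeumannAlgebra.mem_commutant_iff.2 h

theorem Context.cfc_mem (V : Context H) {a : H →L[ℂ] H} (ha : a ∈ V.alg) (f : ℝ → ℝ) :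
    cfc f a ∈ V.alg :=
  V.mem_of_commute fun y hy =>
    (((show Commute a y from VonNeumannAlgebra.mem_commutant_iff.1 hy a ha).cfc_real f).eq).symm

/-- The kernel of a character is approximated by projections in the kernel. -/
theorem exists_proj_of_apply_eq_zero (V : Context H) (χ : V.Elem →ₐ[ℂ] ℂ) (k : V.Elem)
    (hk : χ k = 0) {ε : ℝ} (hε : 0 < ε) :
    ∃ e : V.Elem, IsStarProjection (e : H →L[ℂ] H) ∧ χ e = 0 ∧
      ‖(k : H →L[ℂ] H) * (1 - e)‖ ≤ ε := by
  set t : H →L[ℂ] H := star (k : H →L[ℂ] H) * k with ht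
  have htV : t ∈ V.alg := mul_mem (star_mem k.2) k.2
  have htsa : IsSelfAdjoint t := IsSelfAdjoint.star_mul_self _
  have htnn : 0 ≤ t := star_mul_self_nonneg _
  have hχt : χ (⟨t, htV⟩ : V.Elem) = 0 := by
    have : (⟨t, htV⟩ : V.Elem) = (⟨star (k : H →L[ℂ] H), star_mem k.2⟩ : V.Elem) * k :=
      Subtype.ext rfl
    rw [this, map_mul, hk, mul_zero]
  have hε2 : 0 < ε ^ 2 := by positivity
  set f : ℝ → ℝ := fun x => max x (ε ^ 2) - ε ^ 2 with hf
  set u : ℝ → ℝ := fun x => (max x (ε ^ 2))⁻¹ with hu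
  have hm0 : ∀ x : ℝ, max x (ε ^ 2) ≠ 0 := fun x => (lt_max_of_lt_right hε2).ne'
  have hfc : Continuous f := by fun_prop
  have huc : Continuous u := (by fun_prop : Continuous fun x : ℝ => max x (ε ^ 2)).inv₀ hm0
  set F : H →L[ℂ] H := cfc f t with hF
  set R : H →L[ℂ] H := cfc u t with hR
  have hFV : F ∈ V.alg := V.cfc_mem htV f
  have hRV : R ∈ V.alg := V.cfc_mem htV u
  have hFsa : IsSelfAdjoint F := cfc_predicate f t
  have htRF : t * R * F = F := by
    have h1 : t * R = cfc (fun x => x * u x) t := by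
      rw [cfc_mul (fun x => x) u t (by fun_prop) huc.continuousOn, cfc_id' ℝ t]
    rw [h1, hF, ← cfc_mul _ f t (by fun_prop) hfc.continuousOn]
    refine cfc_congr fun x _ => ?_
    simp only [hf, hu]
    rcases le_total x (ε ^ 2) with h | h
    · simp [max_eq_right h]
    · rw [max_eq_left h, mul_inv_cancel₀ (hε2.trans_le h).ne', one_mul]
  have hnorm : ‖t - F‖ ≤ ε ^ 2 := by
    have h1 : t - F = cfc (fun x => x - f x) t := by
      rw [cfc_sub (fun x => x) f t (by fun_prop) hfc.continuousOn, cfc_id' ℝ t]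
    rw [h1]
    refine norm_cfc_le hε2.le fun x hx => ?_
    have hx0 : 0 ≤ x := spectrum_nonneg_of_nonneg htnn hx
    simp only [hf, Real.norm_eq_abs]
    rw [abs_le]
    rcases le_total x (ε ^ 2) with h | h
    · rw [max_eq_right h]; constructor <;> linarith
    · rw [max_eq_left h]; constructor <;> linarith
  let K : Submodule ℂ H := (LinearMap.range (F : H →ₗ[ℂ] H)).topologicalClosure
  have : CompleteSpace K :=
    (Submodule.isClosed_topologicalClosure (LinearMap.range (F : H →ₗ[ℂ] H))).completeSpace_coe
  set e : H →L[ℂ] H := K.starProjection with he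
  have hep : IsStarProjection e := isStarProjection_starProjection
  have hFK : ∀ x, F x ∈ K := fun x => Submodule.le_topologicalClosure _ ⟨x, rfl⟩
  -- bounded operators that agree on the range of `F` agree on `K`
  have hdense : ∀ a b : H →L[ℂ] H, (∀ x, a (F x) = b (F x)) → ∀ x ∈ K, a x = b x := by
    intro a b hab x hx
    have hcl : IsClosed {x | a x = b x} := isClosed_eq a.continuous b.continuous
    refine hcl.closure_subset_iff.2 ?_ hx
    rintro _ ⟨y, rfl⟩
    exact hab y
  have heV : e ∈ V.alg := by
    refine (VonNeumannAlgebra.IsStarProjection.mem_iff hep V.alg).2 fun y hy => ?_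
    change LinearMap.range (K.starProjection : H →ₗ[ℂ] H) ∈ _
    rw [Submodule.range_starProjection]
    intro x hx
    rw [Submodule.mem_comap]
    have hcl : IsClosed {x | y x ∈ K} :=
      (Submodule.isClosed_topologicalClosure _).preimage y.continuous
    refine hcl.closure_subset_iff.2 ?_ hx
    rintro _ ⟨z, rfl⟩
    have h1 := DFunLike.congr_fun (VonNeumannAlgebra.mem_commutant_iff.1 hy F hFV) z
    have h2 : F (y z) = y (F z) := h1
    change y (F z) ∈ K
    rw [← h2]
    exact hFK _
  have heF : e * F = F := by
    ext x
    exact Submodule.starProjection_eq_self_iff.2 (hFK x)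
  have hFe : F * e = F := by
    have := congrArg star heF
    rwa [star_mul, hep.isSelfAdjoint.star_eq, hFsa.star_eq] at this
  have htRe : t * R * e = e := by
    ext x
    exact hdense (t * R) 1 (fun y => DFunLike.congr_fun htRF y) _
      (Submodule.starProjection_apply_mem K x)
  refine ⟨⟨e, heV⟩, hep, ?_, ?_⟩
  · have : (⟨e, heV⟩ : V.Elem) = ⟨t, htV⟩ * ⟨R, hRV⟩ * ⟨e, heV⟩ := Subtype.ext htRe.symm
    rw [this, map_mul, map_mul, hχt, zero_mul, zero_mul]
  · have h1 : star ((k : H →L[ℂ] H) * (1 - e)) * ((k : H →L[ℂ] H) * (1 - e)) =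
        (1 - e) * ((t - F) * (1 - e)) := by
      rw [star_mul, star_sub, star_one, hep.isSelfAdjoint.star_eq, sub_mul t F,
        mul_sub F 1 e, mul_one, hFe, sub_self, sub_zero, ht]
      simp only [mul_assoc]
    have h2 : ‖(1 : H →L[ℂ] H) - e‖ ≤ 1 := IsStarProjection.norm_le _ hep.one_sub
    have h3 : ‖(k : H →L[ℂ] H) * (1 - e)‖ * ‖(k : H →L[ℂ] H) * (1 - e)‖ ≤ ε ^ 2 := by
      rw [← CStarRing.norm_star_mul_self, h1]
      calc _ ≤ ‖(1 : H →L[ℂ] H) - e‖ * (‖t - F‖ * ‖(1 : H →L[ℂ] H) - e‖) :=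
            (norm_mul_le _ _).trans (by gcongr; exact norm_mul_le _ _)
        _ ≤ 1 * (ε ^ 2 * 1) := by gcongr
        _ = ε ^ 2 := by ring
    nlinarith [norm_nonneg ((k : H →L[ℂ] H) * (1 - e))]

theorem Context.isClosed (V : Context H) : IsClosed (V.alg : Set (H →L[ℂ] H)) := by
  rw [← VonNeumannAlgebra.centralizer_centralizer V.alg]
  exact Set.isClosed_centralizer _

/-- The set of all `b` in `V` such that `b p` is small on the complements of projections in the
kernel of the character `χ` of the subcontext `V'`. -/
noncomputable def extensionSubgroup {V' V : Context H} (h : V' ≤ V) (χ : V'.Elem →ₐ[ℂ] ℂ)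
    (p : V.Elem) : AddSubgroup V.Elem where
  carrier := {b | ∀ ε : ℝ, 0 < ε → ∃ e : V'.Elem, IsStarProjection (e : H →L[ℂ] H) ∧ χ e = 0 ∧
    ‖((b * p * (1 - Context.incl h e) : V.Elem) : H →L[ℂ] H)‖ ≤ ε}
  zero_mem' := fun ε hε => ⟨0, IsStarProjection.zero _, map_zero χ, by simpa using hε.le⟩
  neg_mem' := fun {b} hb ε hε => by
    obtain ⟨e, h1, h2, h3⟩ := hb ε hε
    refine ⟨e, h1, h2, ?_⟩
    simpa [neg_mul] using h3
  add_mem' := fun {b c} hb hc ε hε => by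
    obtain ⟨e, he, hχe, hbe⟩ := hb (ε / 2) (by positivity)
    obtain ⟨e', he', hχe', hce⟩ := hc (ε / 2) (by positivity)
    have hcomm : Commute (1 - (e : H →L[ℂ] H)) (1 - (e' : H →L[ℂ] H)) :=
      ((Commute.one_left _).sub_left ((Commute.one_right _).sub_right
        (V'.comm _ e.2 _ e'.2)))
    have hfac : 1 - ((1 - (1 - e) * (1 - e') : V'.Elem) : H →L[ℂ] H) =
        (1 - (e : H →L[ℂ] H)) * (1 - (e' : H →L[ℂ] H)) := by
      simp
    refine ⟨1 - (1 - e) * (1 - e'), ?_, ?_, ?_⟩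
    · have := (he.one_sub.mul he'.one_sub hcomm).one_sub
      rwa [← hfac, sub_sub_cancel] at this
    · simp [hχe, hχe']
    · have hbn : ‖(1 : H →L[ℂ] H) - e‖ ≤ 1 := IsStarProjection.norm_le _ he.one_sub
      have hbn' : ‖(1 : H →L[ℂ] H) - e'‖ ≤ 1 := IsStarProjection.norm_le _ he'.one_sub
      have key : (((b + c) * p * (1 - Context.incl h (1 - (1 - e) * (1 - e'))) : V.Elem) :
          H →L[ℂ] H) =
          ((b * p * (1 - Context.incl h e) : V.Elem) : H →L[ℂ] H) * (1 - e') +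
          ((c * p * (1 - Context.incl h e') : V.Elem) : H →L[ℂ] H) * (1 - e) := by
        have h1 : (1 - Context.incl h (1 - (1 - e) * (1 - e')) : V.Elem) =
          (1 - Context.incl h e) * (1 - Context.incl h e') := by simp
        have h2 : (1 - Context.incl h e) * (1 - Context.incl h e') =
          (1 - Context.incl h e') * (1 - Context.incl h e) := Subtype.ext hcomm.eq
        rw [h1, add_mul, add_mul]
        nth_rewrite 2 [h2]
        simp only [← mul_assoc]
        rfl
      rw [key]
      calc _ ≤ ε / 2 * 1 + ε / 2 * 1 := by
            refine (norm_add_le _ _).trans (add_le_add ?_ ?_)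
            · exact (norm_mul_le _ _).trans (by gcongr)
            · exact (norm_mul_le _ _).trans (by gcongr)
        _ = ε := by ring

/-- A character `χ` of a subcontext extends to a character with value `1` on the projection `p` as
soon as `χ` has value `1` on the smallest projection of the subcontext above `p`. -/
theorem exists_extension {V' V : Context H} (h : V' ≤ V) (χ : V'.Elem →ₐ[ℂ] ℂ) (p : V.Elem)
    (hp : IsStarProjection (p : H →L[ℂ] H))
    (hχ : ∀ e : V'.Elem, IsStarProjection (e : H →L[ℂ] H) → (e : H →L[ℂ] H) * p = p → χ e ≠ 0) :
    ∃ φ : V.Elem →ₐ[ℂ] ℂ, φ p = 1 ∧ φ.comp (Context.incl h) = χ := by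
  let _ : NormedCommRing V.Elem :=
    { (inferInstance : NormedRing V.Elem) with
      mul_comm := fun a b => Subtype.ext (V.comm _ a.2 _ b.2) }
  have : CompleteSpace V.Elem := V.isClosed.completeSpace_coe
  let I : Ideal V.Elem :=
    { (extensionSubgroup h χ p).toAddSubmonoid with
      smul_mem' := fun c b hb ε hε => by
        obtain ⟨e, h1, h2, h3⟩ := hb (ε / (‖c‖ + 1)) (by positivity)
        refine ⟨e, h1, h2, ?_⟩
        have : c • b * p * (1 - Context.incl h e) = c * (b * p * (1 - Context.incl h e)) := by
          simp only [smul_eq_mul, mul_assoc]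
        rw [this]
        calc _ ≤ ‖c‖ * (ε / (‖c‖ + 1)) := (norm_mul_le c _).trans (by gcongr; exact h3)
          _ ≤ (‖c‖ + 1) * (ε / (‖c‖ + 1)) := by gcongr; linarith
          _ = ε := mul_div_cancel₀ ε (by positivity) }
  have hmem : ∀ b, b ∈ I ↔ ∀ ε : ℝ, 0 < ε → ∃ e : V'.Elem, IsStarProjection (e : H →L[ℂ] H) ∧
      χ e = 0 ∧ ‖((b * p * (1 - Context.incl h e) : V.Elem) : H →L[ℂ] H)‖ ≤ ε := fun _ => Iff.rfl
  have hI : I ≠ ⊤ := by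
    rw [Ne, Ideal.eq_top_iff_one, hmem]
    intro h1
    obtain ⟨e, he, hχe, hn⟩ := h1 (1 / 2) (by norm_num)
    rw [one_mul] at hn
    refine hχ e he ?_ hχe
    have hc : Commute (p : H →L[ℂ] H) (1 - e) :=
      (Commute.one_right _).sub_right (V.comm _ p.2 _ (h e.2))
    have hid : IsIdempotentElem ((p : H →L[ℂ] H) * (1 - e)) :=
      (hp.mul he.one_sub hc).isIdempotentElem
    have hn' : ‖(p : H →L[ℂ] H) * (1 - e)‖ ≤ 1 / 2 := hn
    have h3 := norm_mul_le ((p : H →L[ℂ] H) * (1 - e)) ((p : H →L[ℂ] H) * (1 - e))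
    rw [hid.eq] at h3
    have h4 : (p : H →L[ℂ] H) * (1 - e) = 0 := by
      rw [← norm_le_zero_iff]
      nlinarith [norm_nonneg ((p : H →L[ℂ] H) * (1 - e))]
    rw [hc.eq, sub_mul, one_mul, sub_eq_zero] at h4
    exact h4.symm
  obtain ⟨M, hM, hIM⟩ := Ideal.exists_le_maximal I hI
  let φ : V.Elem →ₐ[ℂ] ℂ := WeakDual.CharacterSpace.equivAlgHom M.toCharacterSpace
  have hφ : ∀ b ∈ I, φ b = 0 := fun b hb => M.toCharacterSpace_apply_eq_zero_of_mem (hIM hb)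
  refine ⟨φ, ?_, ?_⟩
  · have : (1 - p) ∈ I := by
      rw [hmem]
      intro ε hε
      refine ⟨0, IsStarProjection.zero _, map_zero χ, ?_⟩
      have : (1 - p) * p = 0 := by
        apply Subtype.ext
        exact hp.one_sub_mul_self
      rw [this, zero_mul]
      simpa using hε.le
    have h1 := hφ _ this
    rw [map_sub, map_one, sub_eq_zero] at h1
    exact h1.symm
  · ext a
    have : Context.incl h (a - algebraMap ℂ V'.Elem (χ a)) ∈ I := by
      rw [hmem]
      intro ε hε
      obtain ⟨e, h1, h2, h3⟩ := exists_proj_of_apply_eq_zero V' χ (a - algebraMap ℂ V'.Elem (χ a))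
        (by rw [map_sub, AlgHom.commutes]; simp) hε
      refine ⟨e, h1, h2, ?_⟩
      rw [mul_comm _ p, mul_assoc]
      have hpn : ‖(p : H →L[ℂ] H)‖ ≤ 1 := IsStarProjection.norm_le _ hp
      refine (norm_mul_le (p : H →L[ℂ] H) _).trans ?_
      calc _ ≤ 1 * ε := by gcongr; exact h3
        _ = ε := one_mul _
    have h1 := hφ _ this
    rw [map_sub, map_sub, AlgHom.commutes, AlgHom.commutes, sub_eq_zero] at h1
    exact h1

theorem daseinSub_restrictsOnto (p : ProjOp H) : RestrictsOnto (daseinSub p) := by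
  intro V V' h χ₀ hχ₀
  let χ : V'.Elem →ₐ[ℂ] ℂ := χ₀
  have hχ : χ (daseinElem p V') = 1 := hχ₀
  obtain ⟨φ, h1, h2⟩ := exists_extension h χ (daseinElem p V) (dasein p V).2 (by
    intro e he hep h0
    have hle : dasein p V' ≤ ⟨e, he⟩ :=
      (dasein_isLeast p V').2 ⟨e.2, (dasein_isLeast p V).1.2.trans (ProjOp.le_iff_mul.2 hep)⟩
    have hmul : e * daseinElem p V' = daseinElem p V' := Subtype.ext (ProjOp.le_iff_mul.1 hle)
    have := congrArg χ hmul
    rw [map_mul, h0, zero_mul, hχ] at this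
    exact zero_ne_one this)
  exact ⟨φ, h1, h2⟩

/-! ## States and propositions -/

/-- A pure state, represented by a unit vector. -/
structure PureState (H : Type u) [NormedAddCommGroup H] [InnerProductSpace ℂ H] where
  vec : H
  norm_vec : ‖vec‖ = 1

/-- The image of a state under a unitary map. -/
def PureState.map {H' : Type u} [NormedAddCommGroup H'] [InnerProductSpace ℂ H']
    (U : H ≃ₗᵢ[ℂ] H') (ψ : PureState H) : PureState H' :=
  ⟨U ψ.vec, by rw [U.norm_map, ψ.norm_vec]⟩

/-- The projection `|ψ⟩⟨ψ|`. -/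
noncomputable def PureState.proj (ψ : PureState H) : ProjOp H :=
  ⟨InnerProductSpace.rankOne ℂ ψ.vec ψ.vec,
    InnerProductSpace.isStarProjection_rankOne_self ψ.norm_vec⟩

/-- The pseudo-state `𝔴^ψ`. -/
noncomputable def pseudoState (ψ : PureState H) : Subfunctor (spectralPresheaf H) :=
  daseinSub ψ.proj

theorem pseudoState_restrictsOnto (ψ : PureState H) : RestrictsOnto (pseudoState ψ) :=
  daseinSub_restrictsOnto _

open MeasureTheory in
/-- A projection-valued measure on the Borel sets of the real line. -/
structure SpectralFamily (H : Type u) [NormedAddCommGroup H] [InnerProductSpace ℂ H]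
    [CompleteSpace H] where
  toFun : {Δ : Set ℝ // MeasurableSet Δ} → ProjOp H
  univ : (toFun ⟨Set.univ, MeasurableSet.univ⟩ : H →L[ℂ] H) = 1
  iUnion : ∀ (Δ : ℕ → {Δ : Set ℝ // MeasurableSet Δ}),
    Pairwise (fun i j => Disjoint (Δ i : Set ℝ) (Δ j : Set ℝ)) → ∀ x : H,
      HasSum (fun i => (toFun (Δ i) : H →L[ℂ] H) x)
        ((toFun ⟨⋃ i, (Δ i : Set ℝ), MeasurableSet.iUnion fun i => (Δ i).2⟩ : H →L[ℂ] H) x)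

theorem ProjOp.inner_apply_self (p : ProjOp H) (x : H) :
    inner ℂ x ((p : H →L[ℂ] H) x) = ((‖(p : H →L[ℂ] H) x‖ ^ 2 : ℝ) : ℂ) := by
  have h1 : (p : H →L[ℂ] H) x = (p : H →L[ℂ] H) ((p : H →L[ℂ] H) x) :=
    (DFunLike.congr_fun p.2.isIdempotentElem.eq x).symm
  have h2 := p.2.isSelfAdjoint.isSymmetric x ((p : H →L[ℂ] H) x)
  have h3 : inner ℂ ((p : H →L[ℂ] H) x) ((p : H →L[ℂ] H) x) =
      inner ℂ x ((p : H →L[ℂ] H) ((p : H →L[ℂ] H) x)) := h2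
  rw [← h1, inner_self_eq_norm_sq_to_K] at h3
  rw [← h3]
  norm_cast

/-- The measure `Δ ↦ ‖E(Δ) x‖² = ⟨x, E(Δ) x⟩`. -/
noncomputable def SpectralFamily.measure (E : SpectralFamily H) (x : H) :
    MeasureTheory.Measure ℝ :=
  MeasureTheory.Measure.ofMeasurable
    (fun Δ hΔ => ENNReal.ofReal (‖(E.toFun ⟨Δ, hΔ⟩ : H →L[ℂ] H) x‖ ^ 2))
    (by
      have h := E.iUnion (fun _ => ⟨∅, MeasurableSet.empty⟩) (fun _ _ _ => disjoint_bot_left) x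
      have h0 := tendsto_nhds_unique h.summable.tendsto_atTop_zero tendsto_const_nhds
      have h1 : (E.toFun ⟨∅, MeasurableSet.empty⟩ : H →L[ℂ] H) x = 0 := h0.symm
      rw [h1, norm_zero, zero_pow two_ne_zero, ENNReal.ofReal_zero])
    (by
      intro Δ hΔ hd
      have h := E.iUnion (fun i => ⟨Δ i, hΔ i⟩) hd x
      have h1 := (h.mapL (innerSL ℂ x))
      simp only [innerSL_apply_apply, ProjOp.inner_apply_self] at h1
      have h2 := Complex.hasSum_ofReal.1 h1
      rw [← h2.tsum_eq]
      exact ENNReal.ofReal_tsum_of_nonneg (fun _ => by positivity) h2.summable)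

/-- `E` is the spectral family of the (possibly unbounded) operator `A`, that is, `A = ∫ l dE(l)`:
the domain of `A` consists of the `x` with `∫ l² d⟨x, E(l) x⟩ < ∞`, and
`⟨x, A x⟩ = ∫ l d⟨x, E(l) x⟩` there. -/
def IsSpectralFamilyOf (E : SpectralFamily H) (A : H →ₗ.[ℂ] H) : Prop :=
  (∀ x : H, x ∈ A.domain ↔ MeasureTheory.Integrable (fun l : ℝ => l ^ 2) (E.measure x)) ∧
  ∀ x : A.domain, inner ℂ (x : H) (A x) = ((∫ l, l ∂(E.measure (x : H)) : ℝ) : ℂ)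

/-- The truth value `v(𝔴^ψ ⊆ S)` of a single-time subobject. -/
noncomputable def stateTruth (ψ : PureState H) (S : Subfunctor (spectralPresheaf H)) :
    GammaOmega (Context H) :=
  truthValue (pseudoState ψ) S (pseudoState_restrictsOnto ψ)

variable {H' : Type u} [NormedAddCommGroup H'] [InnerProductSpace ℂ H'] [CompleteSpace H']

/-- The truth value `v(𝔴^ψ ⊗ 𝔴^ψ' ⊆ R)` of an element `R` of the tensor product
`Sub(Σ) ⊗ Sub(Σ')`, elements of which are regarded as subobjects of `p₁^* Σ × p₂^* Σ'`. -/
noncomputable def historyTruth (ψ : PureState H) (ψ' : PureState H')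
    (R : FrameTensor (Subfunctor (spectralPresheaf H)) (Subfunctor (spectralPresheaf H'))) :
    GammaOmega (StagePair (Context H) (Context H')) :=
  truthValue (hHom _ _ (FrameTensor.tmul (pseudoState ψ) (pseudoState ψ'))) (hHom _ _ R)
    ((pseudoState_restrictsOnto ψ).hHom (pseudoState_restrictsOnto ψ'))

/-- The truth value of the proposition `A ∈ Δ` with spectral projector `p`. -/
noncomputable def propTruth (p : ProjOp H) (ψ : PureState H) : GammaOmega (Context H) :=
  stateTruth ψ (daseinSub p)

/-- The truth value of the homogeneous history `(A ∈ Δ) ⊓ (A' ∈ Δ')` with spectral projectors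
`p` and `p'`, which is represented by `δ(p) ⊗ δ(p')`. -/
noncomputable def homogeneousTruth (p : ProjOp H) (p' : ProjOp H') (ψ : PureState H)
    (ψ' : PureState H') : GammaOmega (StagePair (Context H) (Context H')) :=
  historyTruth ψ ψ' (FrameTensor.tmul (daseinSub p) (daseinSub p'))

end Hilbert

/-!
A global element of the subobject classifier of presheaves on a poset `P` is the same as a lower set
of `P`, namely the set of stages at which its sieve is maximal; the lower set `↓ V` is the element
`GammaOmega.principal V`, and every element is a join of these. An element `D` of the tensor product
is closed under joins in each variable, hence is determined by the pairs `(↓ V, ↓ W)` it contains,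
and these are exactly the pairs for which `⟨V, W⟩` lies in the lower set of `j D`. This is
`mem_carrier_iff_prodGamma_le`, which says that `D` is recovered from `j D` by the right adjoint of
`j`; so `j` is injective. It is surjective because a lower set of pairs is the union of the
rectangles `↓ V × ↓ W` it contains.

The sieve of `v(𝔴₁ ⊗ 𝔴₂ ⊆ S₁ ⊗ S₂)` consists of the stages where the rectangle `𝔴₁ × 𝔴₂` is contained
in the rectangle `S₁ × S₂`. Containment of rectangles is containment of both sides as soon as the
smaller rectangle has nonempty sides, so the product formula rests on `pseudoState_nonempty`: the
daseinization of a nonzero projection `p` is a nonzero projection `q`, hence `1 - q` is not invertible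
in the commutative Banach algebra `V`, and some character of `V` takes the value `1` on `q`.
-/

/-! ### Global elements of the subobject classifier as lower sets -/

namespace GammaOmega

variable {P : Type u} [PartialOrder P]

theorem mem_stage_iff_mem_stage_self (ω : GammaOmega P) {V W : P} :
    W ∈ ω.stage V ↔ W ≤ V ∧ W ∈ ω.stage W := by
  constructor
  · intro h
    exact ⟨ω.le_stage h, (ω.mem_stage_iff (ω.le_stage h)).2 ⟨le_rfl, h⟩⟩
  · rintro ⟨hle, h⟩
    exact ((ω.mem_stage_iff hle).1 h).2

/-- The global element corresponding to the lower set of all stages below `V`. -/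
def principal (V : P) : GammaOmega P :=
  mk (fun X => {W | W ≤ X ∧ W ≤ V}) (fun h => h.1)
    (fun hle h => ⟨hle.trans h.1, hle.trans h.2⟩)
    (fun hle => ⟨fun h => ⟨h.1, h.1.trans hle, h.2⟩, fun h => ⟨h.1, h.2.2⟩⟩)

theorem mem_stage_principal {V W X : P} : W ∈ (principal V).stage X ↔ W ≤ X ∧ W ≤ V := Iff.rfl

theorem principal_le_iff {V : P} {ω : GammaOmega P} : principal V ≤ ω ↔ V ∈ ω.stage V := by
  constructor
  · intro h
    exact le_iff.1 h V ⟨le_rfl, le_rfl⟩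
  · intro h X W hW
    exact ω.mem_stage_iff_mem_stage_self.2
      ⟨hW.1, (ω.mem_stage_iff_mem_stage_self.1 (ω.stage_down hW.2 h)).2⟩

theorem sSup_principal (ω : GammaOmega P) : sSup (principal '' {V | V ∈ ω.stage V}) = ω := by
  refine le_antisymm (sSup_le ?_) fun V W hW => ?_
  · rintro _ ⟨V, hV, rfl⟩
    exact principal_le_iff.2 hV
  · have h := ω.mem_stage_iff_mem_stage_self.1 hW
    exact mem_stage_sSup.2 ⟨_, ⟨W, h.2, rfl⟩, h.1, le_rfl⟩

end GammaOmega

/-! ### The comparison map of the tensor product -/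

section Comparison

variable {P Q : Type u} [PartialOrder P] [PartialOrder Q]

theorem mem_stage_prodGamma {ω₁ : GammaOmega P} {ω₂ : GammaOmega Q} {V W : StagePair P Q} :
    W ∈ (prodGamma ω₁ ω₂).stage V ↔ W.fst ∈ ω₁.stage V.fst ∧ W.snd ∈ ω₂.stage V.snd := Iff.rfl

theorem prodGamma_principal (V : P) (W : Q) :
    prodGamma (GammaOmega.principal V) (GammaOmega.principal W) =
      GammaOmega.principal (StagePair.mk V W) := by
  ext X Y
  exact and_and_and_comm

theorem mem_stage_jHom {D : FrameTensor (GammaOmega P) (GammaOmega Q)} {V W : StagePair P Q} :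
    W ∈ (jHom P Q D).stage V ↔ ∃ x ∈ D.carrier, W ∈ (prodGamma x.1 x.2).stage V :=
  GammaOmega.mem_stage_iSup

/-- An element `D` of the tensor product is recovered from `j D`. The implication from right to left
is checked on principal elements, which suffices because the carrier of `D` is closed under joins in
each variable. -/
theorem mem_carrier_iff_prodGamma_le {D : FrameTensor (GammaOmega P) (GammaOmega Q)}
    {ω₁ : GammaOmega P} {ω₂ : GammaOmega Q} :
    (ω₁, ω₂) ∈ D.carrier ↔ prodGamma ω₁ ω₂ ≤ jHom P Q D := by
  constructor
  · intro h V W hW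
    exact mem_stage_jHom.2 ⟨_, h, hW⟩
  · intro h
    rw [← ω₁.sSup_principal, ← ω₂.sSup_principal]
    refine D.sSup_left _ _ ?_
    rintro _ ⟨V, hV, rfl⟩
    refine D.sSup_right _ _ ?_
    rintro _ ⟨W, hW, rfl⟩
    obtain ⟨x, hx, hx₁, hx₂⟩ :=
      mem_stage_jHom.1 (GammaOmega.le_iff.1 h (StagePair.mk V W)
        (show StagePair.mk V W ∈ _ from ⟨hV, hW⟩))
    exact D.lower (GammaOmega.principal_le_iff.2 hx₁) (GammaOmega.principal_le_iff.2 hx₂) hx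

theorem jHom_injective : Function.Injective (jHom P Q) := by
  intro D E h
  ext ⟨ω₁, ω₂⟩
  rw [mem_carrier_iff_prodGamma_le, mem_carrier_iff_prodGamma_le, h]

theorem jHom_surjective : Function.Surjective (jHom P Q) := by
  intro ω
  refine ⟨prodGamma_isBimorphism.below ω,
    le_antisymm ((prodGamma_isBimorphism.gc _ _).2 le_rfl) fun V W hW => ?_⟩
  have h := ω.mem_stage_iff_mem_stage_self.1 hW
  refine mem_stage_jHom.2
    ⟨(GammaOmega.principal W.fst, GammaOmega.principal W.snd), ?_, ⟨h.1.1, le_rfl⟩, h.1.2, le_rfl⟩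
  change prodGamma (GammaOmega.principal W.fst) (GammaOmega.principal W.snd) ≤ ω
  rw [prodGamma_principal]
  exact GammaOmega.principal_le_iff.2 h.2

theorem jHom_bijective : Function.Bijective (jHom P Q) := ⟨jHom_injective, jHom_surjective⟩

end Comparison

/-! ### Truth values of products of subobjects -/

/-- Containment of products is containment of both factors when the smaller factors are nonempty;
an empty `T₁` at some stage would make the left side hold there whatever `T₂` and `S₂` are. -/
theorem truthValue_hHom_tmul {P Q : Type u} [PartialOrder P] [PartialOrder Q]
    {X : Pᵒᵖ ⥤ Type u} {Y : Qᵒᵖ ⥤ Type u} {T₁ : Subfunctor X} {T₂ : Subfunctor Y}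
    (hT₁ : RestrictsOnto T₁) (hT₂ : RestrictsOnto T₂)
    (hne₁ : ∀ V, (T₁.obj (op V)).Nonempty) (hne₂ : ∀ V, (T₂.obj (op V)).Nonempty)
    (S₁ : Subfunctor X) (S₂ : Subfunctor Y) :
    truthValue (hHom X Y (FrameTensor.tmul T₁ T₂)) (hHom X Y (FrameTensor.tmul S₁ S₂))
        (hT₁.hHom hT₂) =
      prodGamma (truthValue T₁ S₁ hT₁) (truthValue T₂ S₂ hT₂) := by
  ext V W
  change (W ≤ V ∧ (hHom X Y (FrameTensor.tmul T₁ T₂)).obj (op W) ⊆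
      (hHom X Y (FrameTensor.tmul S₁ S₂)).obj (op W)) ↔
    (W.fst ≤ V.fst ∧ T₁.obj (op W.fst) ⊆ S₁.obj (op W.fst)) ∧
      (W.snd ≤ V.snd ∧ T₂.obj (op W.snd) ⊆ S₂.obj (op W.snd))
  rw [hHom_tmul, hHom_tmul, and_and_and_comm, StagePair.le_iff]
  refine and_congr_right fun _ => ⟨fun h => ⟨fun x hx => ?_, fun y hy => ?_⟩, fun h z hz => ?_⟩
  · obtain ⟨y, hy⟩ := hne₂ W.snd
    exact (h (show (x, y) ∈ (prodSub T₁ T₂).obj (op W) from ⟨hx, hy⟩)).1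
  · obtain ⟨x, hx⟩ := hne₁ W.fst
    exact (h (show (x, y) ∈ (prodSub T₁ T₂).obj (op W) from ⟨hx, hy⟩)).2
  · exact ⟨h.1 hz.1, h.2 hz.2⟩

/-! ### Pseudo-states have elements at every stage -/

section PseudoState

variable {H : Type u} [NormedAddCommGroup H] [InnerProductSpace ℂ H] [CompleteSpace H]

theorem Context.exists_character_eq_one (V : Context H) {p : V.Elem} (hp : IsIdempotentElem p)
    (hp0 : p ≠ 0) : ∃ χ : V.Elem →ₐ[ℂ] ℂ, χ p = 1 := by
  let _ : NormedCommRing V.Elem :=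
    { (inferInstance : NormedRing V.Elem) with
      mul_comm := fun a b => Subtype.ext (V.comm _ a.2 _ b.2) }
  have : CompleteSpace V.Elem := V.isClosed.completeSpace_coe
  have hu : ¬IsUnit (1 - p) := fun h => hp0 (h.mul_right_eq_zero.1 hp.one_sub_mul_self)
  obtain ⟨f, hf⟩ := WeakDual.CharacterSpace.exists_apply_eq_zero hu
  let χ : V.Elem →ₐ[ℂ] ℂ := WeakDual.CharacterSpace.equivAlgHom f
  have hχ : χ (1 - p) = 0 := hf
  rw [map_sub, map_one, sub_eq_zero] at hχ
  exact ⟨χ, hχ.symm⟩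

theorem daseinSub_nonempty {p : ProjOp H} (hp : (p : H →L[ℂ] H) ≠ 0) (V : Context H) :
    ((daseinSub p).obj (op V)).Nonempty := by
  have hidem : IsIdempotentElem (daseinElem p V) := Subtype.ext (dasein p V).2.isIdempotentElem.eq
  have hne : daseinElem p V ≠ 0 := by
    intro h
    have h0 : (dasein p V : H →L[ℂ] H) = 0 := congrArg Subtype.val h
    have hmul := ProjOp.le_iff_mul.1 (dasein_isLeast p V).1.2
    rw [h0, zero_mul] at hmul
    exact hp hmul.symm
  exact V.exists_character_eq_one hidem hne

theorem PureState.proj_ne_zero (ψ : PureState H) : (ψ.proj : H →L[ℂ] H) ≠ 0 := by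
  have hψ : ψ.vec ≠ 0 := by
    rw [← norm_ne_zero_iff, ψ.norm_vec]
    exact one_ne_zero
  exact InnerProductSpace.rankOne_ne_zero hψ hψ

theorem pseudoState_nonempty (ψ : PureState H) (V : Context H) :
    ((pseudoState ψ).obj (op V)).Nonempty :=
  daseinSub_nonempty ψ.proj_ne_zero V

variable {H' : Type u} [NormedAddCommGroup H'] [InnerProductSpace ℂ H'] [CompleteSpace H']

theorem historyTruth_tmul (ψ : PureState H) (ψ' : PureState H')
    (S : Subfunctor (spectralPresheaf H)) (S' : Subfunctor (spectralPresheaf H')) :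
    historyTruth ψ ψ' (FrameTensor.tmul S S') = prodGamma (stateTruth ψ S) (stateTruth ψ' S') :=
  truthValue_hHom_tmul _ _ (pseudoState_nonempty ψ) (pseudoState_nonempty ψ') S S'

end PseudoState

theorem mainTheorem3 {H₁ H₂ : Type u}
    [NormedAddCommGroup H₁] [InnerProductSpace ℂ H₁] [CompleteSpace H₁]
    [NormedAddCommGroup H₂] [InnerProductSpace ℂ H₂] [CompleteSpace H₂]
    (U : H₁ ≃ₗᵢ[ℂ] H₁) (ι : H₁ ≃ₗᵢ[ℂ] H₂)
    (ψ₁ : PureState H₁) (ψ₂ : PureState H₂) (hψ : ψ₂ = (ψ₁.map U).map ι) :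
    (Function.Bijective (jHom (Context H₁) (Context H₂)) ∧
      ∀ (ω₁ : GammaOmega (Context H₁)) (ω₂ : GammaOmega (Context H₂))
        (V₁ : Context H₁) (V₂ : Context H₂),
        (jHom (Context H₁) (Context H₂) (FrameTensor.tmul ω₁ ω₂)).stage (StagePair.mk V₁ V₂) =
          {W | W.fst ∈ ω₁.stage V₁ ∧ W.snd ∈ ω₂.stage V₂}) ∧
    (∀ (S₁ : Subfunctor (spectralPresheaf H₁)) (S₂ : Subfunctor (spectralPresheaf H₂)),
      (∀ (V₁ : Context H₁) (V₂ : Context H₂),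
        (historyTruth ψ₁ ψ₂ (FrameTensor.tmul S₁ S₂)).stage (StagePair.mk V₁ V₂) =
          {W | W.fst ∈ (stateTruth ψ₁ S₁).stage V₁ ∧ W.snd ∈ (stateTruth ψ₂ S₂).stage V₂}) ∧
      historyTruth ψ₁ ψ₂ (FrameTensor.tmul S₁ S₂) =
        jHom (Context H₁) (Context H₂)
          (FrameTensor.tmul (stateTruth ψ₁ S₁) (stateTruth ψ₂ S₂))) ∧
    (∀ (A₁ : H₁ →ₗ.[ℂ] H₁) (A₂ : H₂ →ₗ.[ℂ] H₂), IsSelfAdjoint A₁ → IsSelfAdjoint A₂ →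
      ∀ (E₁ : SpectralFamily H₁) (E₂ : SpectralFamily H₂),
        IsSpectralFamilyOf E₁ A₁ → IsSpectralFamilyOf E₂ A₂ →
      ∀ Δ₁ Δ₂ : {Δ : Set ℝ // MeasurableSet Δ},
        homogeneousTruth (E₁.toFun Δ₁) (E₂.toFun Δ₂) ψ₁ ψ₂ =
          jHom (Context H₁) (Context H₂)
            (FrameTensor.tmul (propTruth (E₁.toFun Δ₁) ψ₁) (propTruth (E₂.toFun Δ₂) ψ₂))) := by
  refine ⟨⟨jHom_bijective, fun ω₁ ω₂ V₁ V₂ => ?_⟩, fun S₁ S₂ => ⟨fun V₁ V₂ => ?_, ?_⟩, ?_⟩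
  · rw [jHom_tmul]
    rfl
  · rw [historyTruth_tmul]
    rfl
  · rw [historyTruth_tmul, jHom_tmul]
  · intro A₁ A₂ _ _ E₁ E₂ _ _ Δ₁ Δ₂
    rw [jHom_tmul]
    exact historyTruth_tmul ψ₁ ψ₂ _ _
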